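/- **Proposition (a priori estimate for the backward Euler–Maruyama method).** Let $d,m\in\mathbb N_0$, $T\ge 0$, and let $(\Omega,\mathcal F,(\mathcal F_t)_{t},P)$ be a filtered probability space carrying an $m$-dimensional standard Wiener process $W$ on $[0,T]$ with respect to $(\mathcal F_t)$ (that is, $W$ is adapted and has continuous paths a.s., $W(0)=0$ a.s., and for $0\le s\le t\le T$ the increment $W(t)-W(s)$ is independent of $\mathcal F_s$ and has independent $N(0,t-s)$ components). Let $f:\mathbb R^d\to\mathbb R^d$ be a function, let $g:\mathbb R^d\to\mathbb R^{d\times m}$ be Borel measurable, let $X_0\in\mathbb R^d$ be deterministic, and let $L\ge 0$ be such that $$\langle f(x),x\rangle+\tfrac12|g(x)|^2\le L(1+|x|^2)\qquad\text{for all }x\in\mathbb R^d,$$ where $|\cdot|$ is the Euclidean norm on vectors and the Frobenius norm on matrices. Let $h_0\in(0,(2L)^{-1})$, where $(2L)^{-1}:=\infty$ if $L=0$, and let $p\in(0,1)$. For $h\in(0,h_0)$ let $N_h\in\mathbb N_0$ be determined by $N_hh\le T<(N_h+1)h$ and put $t_j=jh$. Then, for every $h\in(0,h_0)$ and every process $(Y^j)_{0\le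 j\le N_h}$ with $Y^j$ measurable with respect to $\mathcal F_{t_j}$ that satisfies almost surely the backward Euler–Maruyama scheme $$Y^0=X_0,\qquad Y^{j+1}=Y^j+hf(Y^{j+1})+g(Y^j)\bigl(W(t_{j+1})-W(t_j)\bigr),\quad j=0,\dots,N_h-1,$$ we have $$\Bigl\|\sup_{0\le j\le N_h}|Y^j|\Bigr\|_{2p}\le\Bigl(\frac{2-p}{1-p}\Bigr)^{\frac1{2p}}\exp\Bigl(\frac{LT}{1-2h_0L}\Bigr)\Bigl(|X_0|^2+(1-2h_0L)^{-1}\bigl(h_0|g(X_0)|^2+2LT\bigr)\Bigr)^{\frac12},$$ where $\|Z\|_{2p}=(\mathbb E|Z|^{2p})^{1/(2p)}$. In particular the bound does not depend on $h$. -/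

import Mathlib

open MeasureTheory ProbabilityTheory
open scoped NNReal ENNReal Matrix.Norms.Frobenius

/-- The coercivity condition `⟨f(x), x⟩ + ½ |g(x)|² ≤ L (1 + |x|²)` for all `x ∈ ℝᵈ`.
The norm of the matrix `g x` is the Frobenius norm. -/
def CoercivityCondition {d m : ℕ} (f : EuclideanSpace ℝ (Fin d) → EuclideanSpace ℝ (Fin d))
    (g : EuclideanSpace ℝ (Fin d) → Matrix (Fin d) (Fin m) ℝ) (L : ℝ) : Prop :=
  ∀ x, inner ℝ (f x) x + 1 / 2 * ‖g x‖ ^ 2 ≤ L * (1 + ‖x‖ ^ 2)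

/-- `W`, restricted to the time interval `[0, T]`, is an `m`-dimensional standard Wiener process
with respect to the filtration `𝓕`: it is adapted, starts at zero, has almost surely continuous
paths, its increment over `[s, t]` is independent of `𝓕 s`, and the components of that increment
are independent and `N(0, t - s)`-distributed. Times after `T` play no role. -/
structure IsWienerProcessUpTo {Ω : Type*} {mΩ : MeasurableSpace Ω} {m : ℕ} (T : ℝ≥0)
    (𝓕 : Filtration ℝ≥0 mΩ) (W : ℝ≥0 → Ω → EuclideanSpace ℝ (Fin m)) (P : Measure Ω) : Prop where
  adapted : ∀ t ≤ T, Measurable[𝓕 t] (W t)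
  zero : ∀ᵐ ω ∂P, W 0 ω = 0
  continuous_paths : ∀ᵐ ω ∂P, ContinuousOn (fun t => W t ω) (Set.Iic T)
  indep_past : ∀ s t, s ≤ t → t ≤ T →
    Indep (𝓕 s) (MeasurableSpace.comap (fun ω => W t ω - W s ω) inferInstance) P
  indep_components : ∀ s t, s ≤ t → t ≤ T →
    iIndepFun (fun (i : Fin m) ω => W t ω i - W s ω i) P
  gaussian_components : ∀ s t, s ≤ t → t ≤ T → ∀ i : Fin m,
    P.map (fun ω => W t ω i - W s ω i) = gaussianReal 0 (t - s)

/-- `Y⁰, …, Yᴺ` is an adapted solution of the backward Euler–Maruyama scheme with step size `h`: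
`Y⁰ = X₀` and `Yʲ⁺¹ = Yʲ + h f(Yʲ⁺¹) + g(Yʲ) (W((j+1)h) - W(jh))` almost surely for `j < N`,
where `Yʲ` is measurable with respect to `𝓕 (jh)`. -/
structure IsBackwardEulerMaruyama {Ω : Type*} {mΩ : MeasurableSpace Ω} {d m : ℕ}
    (f : EuclideanSpace ℝ (Fin d) → EuclideanSpace ℝ (Fin d))
    (g : EuclideanSpace ℝ (Fin d) → Matrix (Fin d) (Fin m) ℝ)
    (X₀ : EuclideanSpace ℝ (Fin d))
    (𝓕 : Filtration ℝ≥0 mΩ) (W : ℝ≥0 → Ω → EuclideanSpace ℝ (Fin m)) (P : Measure Ω)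
    (h : ℝ≥0) (N : ℕ) (Y : ℕ → Ω → EuclideanSpace ℝ (Fin d)) : Prop where
  adapted : ∀ j ≤ N, Measurable[𝓕 (j * h)] (Y j)
  initial : ∀ᵐ ω ∂P, Y 0 ω = X₀
  step : ∀ j < N, ∀ᵐ ω ∂P,
    Y (j + 1) ω = Y j ω + (h : ℝ) • f (Y (j + 1) ω)
      + Matrix.toEuclideanLin (g (Y j ω)) (W ((j + 1) * h) ω - W (j * h) ω)

/-! Put `b = 1 - 2hL` and `E n = b|Yⁿ|² + h|g(Yⁿ)|²`. Since `Yⁿ + g(Yⁿ)ΔW = Yⁿ⁺¹ - h f(Yⁿ⁺¹)`,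
squaring and using coercivity gives `E (n+1) ≤ |Yⁿ|² + h|g(Yⁿ)|² + 2hL + ξ`, where `ξ` is the
centred `energyIncrement`. After multiplication by `bⁿ⁺¹` this telescopes: `bⁿ E n` is dominated by
`energyMajorant`, a constant `C` plus a weighted sum of the `ξ`.

The majorant is almost surely nonnegative because it dominates an energy. Hence each Gaussian
increment can be integrated out with `lintegral`, without assuming moments of `Y` or `g(Y)` and
without stopping times (`setLIntegral_ofReal_add_energyIncrement`). The maximal inequality then
yields `P(sup |Yʲ|² ≥ t) ≤ D/t` with `D = C / b^(N+1)`. Such a weak `L¹` bound controls moments of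
order `p < 1`, and `D` is estimated uniformly in `h < h₀`. -/

/-! ### Maximal inequality and moments from weak bounds. -/

/-- **Maximal inequality** for nonnegative supermartingales, without integrability assumptions. -/
theorem mul_measure_exists_le_le_lintegral {Ω : Type*} {mΩ : MeasurableSpace Ω} {μ : Measure Ω}
    (ℱ : Filtration ℕ mΩ) (S : ℕ → Ω → ℝ≥0∞) (N : ℕ)
    (hS : ∀ n ≤ N, Measurable[ℱ n] (S n))
    (hsuper : ∀ n < N, ∀ A, MeasurableSet[ℱ n] A → ∫⁻ ω in A, S (n + 1) ω ∂μ ≤ ∫⁻ ω in A, S n ω ∂μ)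
    (c : ℝ≥0∞) :
    c * μ {ω | ∃ n ≤ N, c ≤ S n ω} ≤ ∫⁻ ω, S 0 ω ∂μ := by
  have hB : ∀ n ≤ N, MeasurableSet[ℱ n] {ω | ∃ k ≤ n, c ≤ S k ω} := by
    intro n hn
    have : {ω | ∃ k ≤ n, c ≤ S k ω} = ⋃ k ∈ Set.Iic n, {ω | c ≤ S k ω} := by
      ext ω; simp
    rw [this]
    refine MeasurableSet.biUnion (Set.to_countable _) fun k hk => ?_
    have hk' : Measurable[ℱ n] (S k) := (hS k (le_trans hk hn)).mono (ℱ.mono hk) le_rfl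
    exact @measurableSet_le _ _ _ _ _ (ℱ n) _ _ _ _ _ measurable_const hk'
  -- The left side is the mean of the process stopped on first reaching `c` and truncated to `c`
  -- there; it does not increase with `n`.
  have key : ∀ n ≤ N, c * μ {ω | ∃ k ≤ n, c ≤ S k ω}
      + ∫⁻ ω in {ω | ∃ k ≤ n, c ≤ S k ω}ᶜ, S n ω ∂μ ≤ ∫⁻ ω, S 0 ω ∂μ := by
    intro n
    induction n with
    | zero =>
      intro h0
      have hm := ℱ.le _ _ (hB 0 h0)
      rw [← lintegral_add_compl (μ := μ) (S 0) hm]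
      refine add_le_add ?_ le_rfl
      refine (setLIntegral_const _ _).symm.le.trans (setLIntegral_mono' hm fun ω hω => ?_)
      obtain ⟨k, hk, h⟩ := hω
      rwa [Nat.le_zero.1 hk] at h
    | succ n ih =>
      intro hn
      refine le_trans ?_ (ih (by omega))
      have hm := ℱ.le _ _ (hB n (by omega))
      have hm' := ℱ.le _ _ (hB (n + 1) hn)
      set B := {ω | ∃ k ≤ n, c ≤ S k ω}
      set B' := {ω | ∃ k ≤ n + 1, c ≤ S k ω}
      have hBB : B ⊆ B' := fun ω ⟨k, hk, h⟩ => ⟨k, by omega, h⟩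
      have h1 : ∫⁻ ω in Bᶜ, S (n + 1) ω ∂μ ≤ ∫⁻ ω in Bᶜ, S n ω ∂μ :=
        hsuper n (by omega) _ (MeasurableSet.compl (hB n (by omega)))
      -- On `B' \ B` the level is first reached at time `n + 1`.
      have h2 : c * μ (B' \ B) ≤ ∫⁻ ω in B' \ B, S (n + 1) ω ∂μ := by
        refine (setLIntegral_const _ _).symm.le.trans
          (setLIntegral_mono' (hm'.diff hm) fun ω hω => ?_)
        obtain ⟨⟨k, hk, h⟩, hω'⟩ := hω
        rcases Nat.lt_or_ge n k with hk' | hk'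
        · rwa [show n + 1 = k by omega]
        · exact absurd ⟨k, hk', h⟩ hω'
      have h3 : ∫⁻ ω in Bᶜ, S (n + 1) ω ∂μ
          = ∫⁻ ω in B' \ B, S (n + 1) ω ∂μ + ∫⁻ ω in B'ᶜ, S (n + 1) ω ∂μ := by
        rw [← lintegral_union hm'.compl]
        · congr 2
          ext ω
          have := @hBB ω
          simp only [Set.mem_compl_iff, Set.mem_union, Set.mem_sdiff]
          tauto
        · exact Set.disjoint_left.2 fun ω h h' => h' h.1
      have h4 : μ B' = μ B + μ (B' \ B) := (measure_add_sdiff hm.nullMeasurableSet B' |>.trans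
        (by rw [Set.union_eq_self_of_subset_left hBB])).symm
      calc c * μ B' + ∫⁻ ω in B'ᶜ, S (n + 1) ω ∂μ
          = c * μ B + (c * μ (B' \ B) + ∫⁻ ω in B'ᶜ, S (n + 1) ω ∂μ) := by
            rw [h4]; ring
        _ ≤ c * μ B + ∫⁻ ω in Bᶜ, S (n + 1) ω ∂μ := by rw [h3]; gcongr
        _ ≤ _ := by gcongr
  exact le_self_add.trans (key N le_rfl)

/-- A weak `L¹` bound `μ {t ≤ f} ≤ D / t` controls the moments of order `p < 1`. -/
theorem lintegral_rpow_le_of_measure_le_div {Ω : Type*} {mΩ : MeasurableSpace Ω} {μ : Measure Ω}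
    [IsProbabilityMeasure μ] {f : Ω → ℝ} (hf0 : ∀ ω, 0 ≤ f ω) (hf : AEMeasurable f μ)
    {D : ℝ} (hD : 0 ≤ D) (hfD : ∀ t, 0 < t → μ {ω | t ≤ f ω} ≤ ENNReal.ofReal (D / t))
    {p : ℝ} (hp0 : 0 < p) (hp1 : p < 1) :
    ∫⁻ ω, ENNReal.ofReal (f ω ^ p) ∂μ ≤ ENNReal.ofReal (D ^ p / (1 - p)) := by
  rw [lintegral_rpow_eq_lintegral_meas_le_mul μ (Filter.Eventually.of_forall hf0) hf hp0]
  rcases hD.eq_or_lt with rfl | hD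
  · have : ∫⁻ t in Set.Ioi (0 : ℝ), μ {ω | t ≤ f ω} * ENNReal.ofReal (t ^ (p - 1)) = 0 := by
      rw [setLIntegral_congr_fun (g := fun _ => 0) measurableSet_Ioi]
      · simp
      · intro t ht
        have := hfD t ht
        simp only [zero_div, ENNReal.ofReal_zero, nonpos_iff_eq_zero] at this
        simp [this]
    rw [this]
    simp
  -- Below `D` the trivial bound 1 is better than `D / t`; above `D`, `t ^ (p - 2)` is integrable as
  -- `p < 1`. The total is `p (D^p/p + D^p/(1-p)) = D^p/(1-p)`.
  have hsplit : Set.Ioi (0 : ℝ) = Set.Ioc 0 D ∪ Set.Ioi D := (Set.Ioc_union_Ioi_eq_Ioi hD.le).symm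
  have h1 : ∫⁻ t in Set.Ioc 0 D, μ {ω | t ≤ f ω} * ENNReal.ofReal (t ^ (p - 1))
      ≤ ENNReal.ofReal (D ^ p / p) := by
    have hi : IntegrableOn (fun t : ℝ => t ^ (p - 1)) (Set.Ioc 0 D) :=
      (intervalIntegral.intervalIntegrable_rpow' (by linarith)).1
    calc _ ≤ ∫⁻ t in Set.Ioc 0 D, ENNReal.ofReal (t ^ (p - 1)) := by
          refine lintegral_mono fun t => ?_
          calc _ ≤ 1 * ENNReal.ofReal (t ^ (p - 1)) := by gcongr; exact prob_le_one
            _ = _ := one_mul _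
      _ = ENNReal.ofReal (∫ t in Set.Ioc 0 D, t ^ (p - 1)) := by
          rw [ofReal_integral_eq_lintegral_ofReal hi]
          filter_upwards [ae_restrict_mem measurableSet_Ioc] with t ht
          exact Real.rpow_nonneg ht.1.le _
      _ = _ := by
          rw [← intervalIntegral.integral_of_le hD.le, integral_rpow (Or.inl (by linarith))]
          simp [Real.zero_rpow hp0.ne']
  have h2 : ∫⁻ t in Set.Ioi D, μ {ω | t ≤ f ω} * ENNReal.ofReal (t ^ (p - 1))
      ≤ ENNReal.ofReal (D ^ p / (1 - p)) := by
    have hi : IntegrableOn (fun t : ℝ => D * t ^ (p - 2)) (Set.Ioi D) :=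
      (integrableOn_Ioi_rpow_of_lt (by linarith) hD).const_mul D
    calc _ ≤ ∫⁻ t in Set.Ioi D, ENNReal.ofReal (D * t ^ (p - 2)) := by
          refine setLIntegral_mono' measurableSet_Ioi fun t ht => ?_
          have ht0 : 0 < t := hD.trans ht
          calc _ ≤ ENNReal.ofReal (D / t) * ENNReal.ofReal (t ^ (p - 1)) := by
                gcongr; exact hfD t ht0
            _ = _ := by
                rw [← ENNReal.ofReal_mul (by positivity)]
                congr 1
                rw [show p - 1 = (p - 2) + 1 by ring, Real.rpow_add_one ht0.ne']
                field_simp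
      _ = ENNReal.ofReal (∫ t in Set.Ioi D, D * t ^ (p - 2)) := by
          rw [ofReal_integral_eq_lintegral_ofReal hi]
          filter_upwards [ae_restrict_mem measurableSet_Ioi] with t ht
          have ht0 : 0 < t := hD.trans ht
          positivity
      _ = _ := by
          rw [integral_const_mul, integral_Ioi_rpow_of_lt (by linarith) hD]
          congr 1
          have h1p : 1 - p ≠ 0 := by linarith
          have hDp : D ^ p = D ^ (p - 1) * D := by
            rw [← Real.rpow_add_one hD.ne', sub_add_cancel]
          rw [show p - 2 + 1 = -(1 - p) by ring, hDp, show p - 1 = -(1 - p) by ring]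
          field_simp
  calc _ ≤ ENNReal.ofReal p * (ENNReal.ofReal (D ^ p / p) + ENNReal.ofReal (D ^ p / (1 - p))) := by
        rw [hsplit, lintegral_union measurableSet_Ioi Set.Ioc_disjoint_Ioi_same]
        gcongr
    _ = _ := by
        have : 0 < 1 - p := by linarith
        rw [← ENNReal.ofReal_add (by positivity) (by positivity), ← ENNReal.ofReal_mul hp0.le]
        congr 1
        field_simp
        ring

/-! ### Integrating out independent Gaussian noise. -/

/-- Integrating out an independent variable from a nonnegative quantity. -/
theorem ProbabilityTheory.IndepFun.setLIntegral_ofReal_eq {Ω α β : Type*} {mΩ : MeasurableSpace Ω}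
    {mα : MeasurableSpace α} {mβ : MeasurableSpace β} {μ : Measure Ω} [IsProbabilityMeasure μ]
    {X : Ω → α} {Z : Ω → β} (hXZ : IndepFun X Z μ) (hX : Measurable X) (hZ : Measurable Z)
    {F : α × β → ℝ} (hF : Measurable F) {u : α → ℝ} (hu : Measurable u)
    (hFi : ∀ x, Integrable (fun z => F (x, z)) (μ.map Z))
    (hFu : ∀ x, ∫ z, F (x, z) ∂μ.map Z = u x)
    (hF0 : ∀ᵐ ω ∂μ, 0 ≤ F (X ω, Z ω)) {B : Set α} (hB : MeasurableSet B) :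
    ∫⁻ ω in X ⁻¹' B, ENNReal.ofReal (F (X ω, Z ω)) ∂μ
      = ∫⁻ ω in X ⁻¹' B, ENNReal.ofReal (u (X ω)) ∂μ := by
  have : IsProbabilityMeasure (μ.map Z) := Measure.isProbabilityMeasure_map hZ.aemeasurable
  have : IsProbabilityMeasure (μ.map X) := Measure.isProbabilityMeasure_map hX.aemeasurable
  have hmap := (indepFun_iff_map_prod_eq_prod_map_map hX.aemeasurable hZ.aemeasurable).1 hXZ
  have hXZm : Measurable fun ω => (X ω, Z ω) := hX.prodMk hZ
  -- The joint law is a product, so nonnegativity along `(X, Z)` passes to almost every section,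
  -- where the Bochner and Lebesgue integrals agree.
  have hF0' : ∀ᵐ x ∂μ.map X, ∀ᵐ z ∂μ.map Z, 0 ≤ F (x, z) := by
    refine Measure.ae_ae_of_ae_prod (p := fun q => 0 ≤ F q) ?_
    rw [← hmap, ae_map_iff hXZm.aemeasurable (measurableSet_le measurable_const hF)]
    exact hF0
  have hpre : X ⁻¹' B = (fun ω => (X ω, Z ω)) ⁻¹' (B ×ˢ Set.univ) := by ext; simp
  calc _ = ∫⁻ q in B ×ˢ Set.univ, ENNReal.ofReal (F q) ∂μ.map (fun ω => (X ω, Z ω)) := by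
        rw [hpre, setLIntegral_map (hB.prod MeasurableSet.univ) hF.ennreal_ofReal hXZm]
    _ = ∫⁻ x in B, ∫⁻ z, ENNReal.ofReal (F (x, z)) ∂μ.map Z ∂μ.map X := by
        rw [hmap, ← Measure.prod_restrict, Measure.restrict_univ,
          lintegral_prod _ hF.ennreal_ofReal.aemeasurable]
    _ = ∫⁻ x in B, ENNReal.ofReal (u x) ∂μ.map X := by
        refine lintegral_congr_ae (ae_restrict_of_ae ?_)
        filter_upwards [hF0'] with x hx
        rw [← hFu, ofReal_integral_eq_lintegral_ofReal (hFi x) hx]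
    _ = _ := setLIntegral_map hB hu.ennreal_ofReal hX

theorem Matrix.frobenius_norm_sq {d m : ℕ} (G : Matrix (Fin d) (Fin m) ℝ) :
    ‖G‖ ^ 2 = ∑ i, ∑ k, G i k ^ 2 := by
  rw [Matrix.frobenius_norm_def, ← Real.sqrt_eq_rpow, Real.sq_sqrt (by positivity)]
  simp

theorem Matrix.toEuclideanLin_apply_coord {d m : ℕ} (G : Matrix (Fin d) (Fin m) ℝ)
    (z : EuclideanSpace ℝ (Fin m)) (i : Fin d) :
    Matrix.toEuclideanLin G z i = ∑ k, G i k * z k := rfl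

section Gaussian

variable {Ω : Type*} {mΩ : MeasurableSpace Ω} {μ : Measure Ω} {m : ℕ}
  {Z : Ω → EuclideanSpace ℝ (Fin m)} {v : ℝ≥0}

theorem memLp_two_of_map_gaussianReal {X : Ω → ℝ} (hX : Measurable X)
    (hg : μ.map X = gaussianReal 0 v) : MemLp X 2 μ := by
  have h : MemLp id 2 (μ.map X) := by
    rw [hg]; exact memLp_id_gaussianReal' 2 (by simp)
  exact h.comp_of_map hX.aemeasurable

theorem integral_eq_zero_of_map_gaussianReal {X : Ω → ℝ} (hX : Measurable X)
    (hg : μ.map X = gaussianReal 0 v) : ∫ ω, X ω ∂μ = 0 := by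
  have h := integral_map (μ := μ) hX.aemeasurable (f := fun x : ℝ => x) (by fun_prop)
  rw [← h, hg, integral_id_gaussianReal]

theorem integral_sq_of_map_gaussianReal [IsProbabilityMeasure μ] {X : Ω → ℝ} (hX : Measurable X)
    (hg : μ.map X = gaussianReal 0 v) : ∫ ω, X ω ^ 2 ∂μ = v := by
  have h := integral_map (μ := μ) hX.aemeasurable (f := fun x : ℝ => x ^ 2) (by fun_prop)
  rw [← h, hg]
  have h2 := variance_fun_id_gaussianReal (μ := 0) (v := v)
  rw [variance_eq_integral (by fun_prop), integral_id_gaussianReal] at h2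
  simpa using h2

variable [IsProbabilityMeasure μ]

theorem integral_mul_coord_of_gaussianReal (hZ : Measurable Z)
    (hind : iIndepFun (fun (i : Fin m) ω => Z ω i) μ)
    (hg : ∀ i, μ.map (fun ω => Z ω i) = gaussianReal 0 v) (k l : Fin m) :
    ∫ ω, Z ω k * Z ω l ∂μ = if k = l then (v : ℝ) else 0 := by
  have hZi : ∀ i, Measurable fun ω => Z ω i := fun i => by fun_prop
  split_ifs with h
  · subst h
    simp_rw [← sq]
    exact integral_sq_of_map_gaussianReal (hZi k) (hg k)
  · have := (hind.indepFun h).integral_mul_eq_mul_integral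
      (hZi k).aestronglyMeasurable (hZi l).aestronglyMeasurable
    rw [integral_eq_zero_of_map_gaussianReal (hZi k) (hg k), zero_mul] at this
    exact this

/-- Mean of the quadratic polynomial `|Gz|² + 2⟨Gz, y⟩` under a centred isotropic Gaussian. -/
theorem integrable_and_integral_norm_sq_add_inner (hZ : Measurable Z)
    (hind : iIndepFun (fun (i : Fin m) ω => Z ω i) μ)
    (hg : ∀ i, μ.map (fun ω => Z ω i) = gaussianReal 0 v)
    {d : ℕ} (G : Matrix (Fin d) (Fin m) ℝ) (y : EuclideanSpace ℝ (Fin d)) :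
    Integrable (fun z => ‖Matrix.toEuclideanLin G z‖ ^ 2 + 2 * inner ℝ (Matrix.toEuclideanLin G z) y)
      (μ.map Z) ∧
    ∫ z, (‖Matrix.toEuclideanLin G z‖ ^ 2 + 2 * inner ℝ (Matrix.toEuclideanLin G z) y) ∂μ.map Z
      = v * ‖G‖ ^ 2 := by
  have hZi : ∀ i, Measurable fun ω => Z ω i := fun i => by fun_prop
  have hcont : Continuous fun z => Matrix.toEuclideanLin G z :=
    LinearMap.continuous_of_finiteDimensional _
  have hmeas : AEStronglyMeasurable (fun z => ‖Matrix.toEuclideanLin G z‖ ^ 2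
      + 2 * inner ℝ (Matrix.toEuclideanLin G z) y) (μ.map Z) :=
    Continuous.aestronglyMeasurable (by fun_prop)
  have hL2 : ∀ i, MemLp (fun ω => Z ω i) 2 μ := fun i => memLp_two_of_map_gaussianReal (hZi i) (hg i)
  have hexp : ∀ z, ‖Matrix.toEuclideanLin G z‖ ^ 2 + 2 * inner ℝ (Matrix.toEuclideanLin G z) y
      = (∑ i, ∑ k, ∑ l, G i k * G i l * (z k * z l)) + ∑ i, ∑ k, 2 * y i * G i k * z k := by
    intro z
    rw [EuclideanSpace.real_norm_sq_eq, PiLp.inner_apply, Finset.mul_sum]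
    simp only [Matrix.toEuclideanLin_apply_coord]
    congr 1
    · refine Finset.sum_congr rfl fun i _ => ?_
      rw [sq, Finset.sum_mul_sum]
      refine Finset.sum_congr rfl fun k _ => Finset.sum_congr rfl fun l _ => by ring
    · refine Finset.sum_congr rfl fun i _ => ?_
      simp only [RCLike.inner_apply, conj_trivial, Finset.mul_sum]
      refine Finset.sum_congr rfl fun k _ => by ring
  have hi1 : ∀ i k l, Integrable (fun ω => G i k * G i l * (Z ω k * Z ω l)) μ := fun i k l =>
    ((hL2 k).integrable_mul (hL2 l)).const_mul _
  have hi2 : ∀ i k, Integrable (fun ω => 2 * y i * G i k * Z ω k) μ := fun i k =>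
    ((hL2 k).integrable one_le_two).const_mul _
  have hI1 : Integrable (fun ω => ∑ i, ∑ k, ∑ l, G i k * G i l * (Z ω k * Z ω l)) μ :=
    integrable_finsetSum _ fun i _ => integrable_finsetSum _ fun k _ =>
      integrable_finsetSum _ fun l _ => hi1 i k l
  have hI2 : Integrable (fun ω => ∑ i, ∑ k, 2 * y i * G i k * Z ω k) μ :=
    integrable_finsetSum _ fun i _ => integrable_finsetSum _ fun k _ => hi2 i k
  constructor
  · rw [integrable_map_measure hmeas hZ.aemeasurable]
    refine (hI1.add hI2).congr (Filter.Eventually.of_forall fun ω => ?_)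
    exact (hexp (Z ω)).symm
  · rw [integral_map hZ.aemeasurable hmeas]
    simp_rw [hexp]
    have e1 : ∫ ω, ∑ i, ∑ k, ∑ l, G i k * G i l * (Z ω k * Z ω l) ∂μ = v * ‖G‖ ^ 2 := by
      rw [integral_finsetSum _ fun i _ => integrable_finsetSum _ fun k _ =>
        integrable_finsetSum _ fun l _ => hi1 i k l, Matrix.frobenius_norm_sq, Finset.mul_sum]
      refine Finset.sum_congr rfl fun i _ => ?_
      rw [integral_finsetSum _ fun k _ => integrable_finsetSum _ fun l _ => hi1 i k l,
        Finset.mul_sum]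
      refine Finset.sum_congr rfl fun k _ => ?_
      rw [integral_finsetSum _ fun l _ => hi1 i k l]
      simp_rw [integral_const_mul, integral_mul_coord_of_gaussianReal hZ hind hg]
      simp
      ring
    have e2 : ∫ ω, ∑ i, ∑ k, 2 * y i * G i k * Z ω k ∂μ = 0 := by
      rw [integral_finsetSum _ fun i _ => integrable_finsetSum _ fun k _ => hi2 i k]
      refine Finset.sum_eq_zero fun i _ => ?_
      rw [integral_finsetSum _ fun k _ => hi2 i k]
      refine Finset.sum_eq_zero fun k _ => ?_
      rw [integral_const_mul, integral_eq_zero_of_map_gaussianReal (hZi k) (hg k), mul_zero]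
    rw [integral_add hI1 hI2, e1, e2, add_zero]

end Gaussian

/-! ### Energy estimates for the scheme. -/

/-- One-step energy inequality for an implicit Euler step `y' = y + h f(y') + w` with coercive `f`. -/
theorem CoercivityCondition.energy_step {d m : ℕ}
    {f : EuclideanSpace ℝ (Fin d) → EuclideanSpace ℝ (Fin d)}
    {g : EuclideanSpace ℝ (Fin d) → Matrix (Fin d) (Fin m) ℝ} {L : ℝ}
    (hfg : CoercivityCondition f g L) {h : ℝ} (hh : 0 ≤ h) {y y' w : EuclideanSpace ℝ (Fin d)}
    (hy : y' = y + h • f y' + w) :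
    (1 - 2 * h * L) * ‖y'‖ ^ 2 + h * ‖g y'‖ ^ 2 ≤
      ‖y‖ ^ 2 + 2 * h * L + (‖w‖ ^ 2 + 2 * inner ℝ w y) := by
  have h1 := mul_le_mul_of_nonneg_left (hfg y') hh
  have h2 : ‖y‖ ^ 2 = ‖y' - w‖ ^ 2 - 2 * h * inner ℝ (f y') (y' - w) + h ^ 2 * ‖f y'‖ ^ 2 := by
    have : y = (y' - w) - h • f y' := by
      nth_rewrite 1 [hy]; abel
    rw [this, norm_sub_sq_real, real_inner_smul_right, norm_smul, mul_pow,
      real_inner_comm]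
    simp
    ring
  have h3 : inner ℝ w y = inner ℝ w y' - h * inner ℝ w (f y') - ‖w‖ ^ 2 := by
    have : y = (y' - w) - h • f y' := by
      nth_rewrite 1 [hy]; abel
    rw [this, inner_sub_right, inner_sub_right, real_inner_smul_right, real_inner_self_eq_norm_sq]
    ring
  rw [norm_sub_sq_real, inner_sub_right, real_inner_comm w y', real_inner_comm w (f y')] at h2
  -- `h2` and `h3` combine to `|y + w|² = |y' - h f(y')|²`; the term `h²|f(y')|²` is discarded.
  nlinarith [mul_nonneg (sq_nonneg h) (sq_nonneg ‖f y'‖)]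

/-- The compensated increment `|g(y)w|² + 2⟨g(y)w, y⟩ - h|g(y)|²` of the energy. -/
noncomputable def energyIncrement {d m : ℕ}
    (g : EuclideanSpace ℝ (Fin d) → Matrix (Fin d) (Fin m) ℝ) (h : ℝ)
    (y : EuclideanSpace ℝ (Fin d)) (w : EuclideanSpace ℝ (Fin m)) : ℝ :=
  ‖Matrix.toEuclideanLin (g y) w‖ ^ 2 + 2 * inner ℝ (Matrix.toEuclideanLin (g y) w) y
    - h * ‖g y‖ ^ 2

theorem Measurable.energyIncrement {d m : ℕ}
    {g : EuclideanSpace ℝ (Fin d) → Matrix (Fin d) (Fin m) ℝ}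
    (hg : ∀ i k, Measurable (fun x => g x i k)) (h : ℝ) {α : Type*} {mα : MeasurableSpace α}
    {y : α → EuclideanSpace ℝ (Fin d)} {w : α → EuclideanSpace ℝ (Fin m)}
    (hy : Measurable y) (hw : Measurable w) :
    Measurable fun a => energyIncrement g h (y a) (w a) := by
  have hgy : ∀ i k, Measurable fun a => g (y a) i k := fun i k => (hg i k).comp hy
  have hyi : ∀ i, Measurable fun a => y a i := fun i => by fun_prop
  have hwi : ∀ i, Measurable fun a => w a i := fun i => by fun_prop
  simp only [_root_.energyIncrement, EuclideanSpace.real_norm_sq_eq, PiLp.inner_apply,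
    Matrix.toEuclideanLin_apply_coord, Matrix.frobenius_norm_sq, RCLike.inner_apply, conj_trivial]
  fun_prop

/-- The increments of a filtration-measurable energy process preserve set integrals:
localisation is replaced by nonnegativity. -/
theorem setLIntegral_ofReal_add_energyIncrement {Ω : Type*} {m' mΩ : MeasurableSpace Ω}
    {P : Measure Ω} [IsProbabilityMeasure P] {d m : ℕ}
    {g : EuclideanSpace ℝ (Fin d) → Matrix (Fin d) (Fin m) ℝ}
    (hg : ∀ i k, Measurable (fun x => g x i k)) {v : ℝ≥0} (hm' : m' ≤ mΩ)
    {Z : Ω → EuclideanSpace ℝ (Fin m)} (hZ : Measurable Z)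
    (hindep : Indep m' (MeasurableSpace.comap Z inferInstance) P)
    (hind : iIndepFun (fun (i : Fin m) ω => Z ω i) P)
    (hgauss : ∀ i, P.map (fun ω => Z ω i) = gaussianReal 0 v)
    {s : Ω → ℝ} (hs : Measurable[m'] s) {y : Ω → EuclideanSpace ℝ (Fin d)} (hy : Measurable[m'] y)
    (c : ℝ) (h0 : ∀ᵐ ω ∂P, 0 ≤ s ω + c * energyIncrement g v (y ω) (Z ω))
    {A : Set Ω} (hA : MeasurableSet[m'] A) :
    ∫⁻ ω in A, ENNReal.ofReal (s ω + c * energyIncrement g v (y ω) (Z ω)) ∂P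
      = ∫⁻ ω in A, ENNReal.ofReal (s ω) ∂P := by
  have hprob : IsProbabilityMeasure (P.map Z) := Measure.isProbabilityMeasure_map hZ.aemeasurable
  have hmom := integrable_and_integral_norm_sq_add_inner hZ hind hgauss (d := d)
  have hi : ∀ ω, Integrable (fun z => energyIncrement g v (y ω) z) (P.map Z) := fun ω =>
    (hmom (g (y ω)) (y ω)).1.sub (integrable_const _)
  have hI : ∀ ω, ∫ z, energyIncrement g v (y ω) z ∂P.map Z = 0 := fun ω => by
    simp only [energyIncrement]
    rw [integral_sub (hmom (g (y ω)) (y ω)).1 (integrable_const _), (hmom (g (y ω)) (y ω)).2]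
    simp
  have hF : ∀ {α : Type _} {mα : MeasurableSpace α} {s : α → ℝ} {y : α → EuclideanSpace ℝ (Fin d)},
      Measurable s → Measurable y →
      Measurable fun q : α × EuclideanSpace ℝ (Fin m) => s q.1 + c * energyIncrement g v (y q.1) q.2 :=
    fun hs hy => (hs.comp measurable_fst).add
      ((Measurable.energyIncrement hg v (hy.comp measurable_fst) measurable_snd).const_mul c)
  -- Taking `X = id` into `(Ω, m')` encodes the whole past as a single random variable independent
  -- of `Z`.
  refine IndepFun.setLIntegral_ofReal_eq (mα := m') (X := id) (Z := Z) (u := s) (μ := P)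
    (F := fun q => s q.1 + c * energyIncrement g v (y q.1) q.2) ?_ (fun t ht => hm' t ht) hZ
    (hF hs hy) hs ?_ ?_ h0 hA
  · refine (@IndepFun_iff_Indep _ _ _ _ m' _ id Z P).2 ?_
    rw [MeasurableSpace.comap_id]
    exact hindep
  · exact fun ω => (integrable_const (s ω)).add ((hi ω).const_mul c)
  · intro ω
    rw [integral_add (integrable_const (s ω)) ((hi ω).const_mul c), integral_const_mul, hI]
    simp

/-- Nonnegative energy dominating the backward Euler–Maruyama scheme. -/
noncomputable def energyMajorant {Ω : Type*} {d m : ℕ}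
    (g : EuclideanSpace ℝ (Fin d) → Matrix (Fin d) (Fin m) ℝ)
    (W : ℝ≥0 → Ω → EuclideanSpace ℝ (Fin m)) (h : ℝ≥0) (Y : ℕ → Ω → EuclideanSpace ℝ (Fin d))
    (b C : ℝ) (n : ℕ) (ω : Ω) : ℝ :=
  C + ∑ k ∈ Finset.range n,
    b ^ (k + 1) * energyIncrement g h (Y k ω) (W ((k + 1) * h) ω - W (k * h) ω)

section Scheme

variable {Ω : Type*} {mΩ : MeasurableSpace Ω} {P : Measure Ω} {d m : ℕ} {T : ℝ≥0}
  {𝓕 : Filtration ℝ≥0 mΩ} {W : ℝ≥0 → Ω → EuclideanSpace ℝ (Fin m)}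
  {f : EuclideanSpace ℝ (Fin d) → EuclideanSpace ℝ (Fin d)}
  {g : EuclideanSpace ℝ (Fin d) → Matrix (Fin d) (Fin m) ℝ}
  {X₀ : EuclideanSpace ℝ (Fin d)} {L : ℝ} {h : ℝ≥0} {N : ℕ}
  {Y : ℕ → Ω → EuclideanSpace ℝ (Fin d)}

/-- The energy of the scheme is almost surely dominated by `energyMajorant`. -/
theorem IsBackwardEulerMaruyama.ae_energy_le
    (hY : IsBackwardEulerMaruyama f g X₀ 𝓕 W P h N Y) (hfg : CoercivityCondition f g L)
    (hL : 0 ≤ L) (hb : 0 ≤ 1 - 2 * h * L) :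
    ∀ᵐ ω ∂P, ∀ n ≤ N,
      (1 - 2 * h * L) ^ n * ((1 - 2 * h * L) * ‖Y n ω‖ ^ 2 + h * ‖g (Y n ω)‖ ^ 2) ≤
        energyMajorant g W h Y (1 - 2 * h * L)
          ((1 - 2 * h * L) * ‖X₀‖ ^ 2 + h * ‖g X₀‖ ^ 2 + 2 * N * h * L) n ω := by
  have hstep : ∀ᵐ ω ∂P, ∀ j < N, Y (j + 1) ω = Y j ω + (h : ℝ) • f (Y (j + 1) ω)
      + Matrix.toEuclideanLin (g (Y j ω)) (W ((j + 1) * h) ω - W (j * h) ω) := by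
    rw [ae_all_iff]; intro j
    rw [ae_all_iff]; exact hY.step j
  filter_upwards [hY.initial, hstep] with ω h0 hst
  set b : ℝ := 1 - 2 * h * L with hbdef
  have hh : (0 : ℝ) ≤ h := h.2
  have hb1 : b ≤ 1 := by have := mul_nonneg hh hL; linarith
  -- `C` contains the drift `2NhL` of all steps in advance; the subtracted term is the part not yet
  -- used at time `n`.
  have key : ∀ n ≤ N, b ^ n * (b * ‖Y n ω‖ ^ 2 + h * ‖g (Y n ω)‖ ^ 2) ≤
      energyMajorant g W h Y b (b * ‖X₀‖ ^ 2 + h * ‖g X₀‖ ^ 2 + 2 * N * h * L) n ω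
        - 2 * (N - n) * h * L := by
    intro n
    induction n with
    | zero =>
      intro _
      simp [energyMajorant, h0]
    | succ n ih =>
      intro hn
      have h1 := ih (by omega)
      have h2 := hfg.energy_step hh (hst n (by omega))
      have h3 := mul_le_mul_of_nonneg_left h2 (pow_nonneg hb (n + 1))
      have hbn : b ^ (n + 1) ≤ 1 := pow_le_one₀ hb hb1
      have h4 : b ^ (n + 1) * (2 * h * L) ≤ 2 * h * L :=
        mul_le_of_le_one_left (by positivity) hbn
      have h5 : b ^ (n + 1) * (h * ‖g (Y n ω)‖ ^ 2) ≤ b ^ n * (h * ‖g (Y n ω)‖ ^ 2) :=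
        mul_le_mul_of_nonneg_right (pow_le_pow_of_le_one hb hb1 (Nat.le_succ n)) (by positivity)
      simp only [energyMajorant, Finset.sum_range_succ] at h1 ⊢
      simp only [energyIncrement] at h1 ⊢
      push_cast
      rw [← hbdef] at h3
      rw [pow_succ] at *
      linarith
  intro n hn
  refine (key n hn).trans (sub_le_self _ ?_)
  have : (n : ℝ) ≤ N := by exact_mod_cast hn
  have : 0 ≤ (N : ℝ) - n := by linarith
  positivity

/-- Weak `L¹` bound for the running maximum of the scheme. -/
theorem IsBackwardEulerMaruyama.measure_le_iSup_sq_le [IsProbabilityMeasure P]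
    (hW : IsWienerProcessUpTo T 𝓕 W P) (hg : ∀ i k, Measurable (fun x => g x i k))
    (hY : IsBackwardEulerMaruyama f g X₀ 𝓕 W P h N Y) (hfg : CoercivityCondition f g L)
    (hL : 0 ≤ L) (hb : 0 < 1 - 2 * h * L) (hN : N * h ≤ T) {t : ℝ} (ht : 0 < t) :
    P {ω | t ≤ (⨆ j : Fin (N + 1), ‖Y j ω‖) ^ 2} ≤
      ENNReal.ofReal (((1 - 2 * h * L) * ‖X₀‖ ^ 2 + h * ‖g X₀‖ ^ 2 + 2 * N * h * L)
        / (1 - 2 * h * L) ^ (N + 1) / t) := by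
  have hae := hY.ae_energy_le hfg hL hb.le
  set b : ℝ := 1 - 2 * h * L with hbdef
  set C : ℝ := b * ‖X₀‖ ^ 2 + h * ‖g X₀‖ ^ 2 + 2 * N * h * L with hC
  have hh : (0 : ℝ) ≤ h := h.2
  have hb1 : b ≤ 1 := by have := mul_nonneg hh hL; linarith
  -- The filtration sampled at the grid times.
  let ℱ : Filtration ℕ mΩ :=
    { seq := fun n => 𝓕 (n * h)
      mono' := fun i j hij => 𝓕.mono (by gcongr)
      le' := fun n => 𝓕.le _ }
  have htime : ∀ n ≤ N, (n : ℝ≥0) * h ≤ T := fun n hn => le_trans (by gcongr) hN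
  have htime' : ∀ n < N, ((n : ℝ≥0) + 1) * h ≤ T := fun n hn => by
    have := htime (n + 1) hn
    push_cast at this
    exact this
  have hle : ∀ n : ℕ, (n : ℝ≥0) * h ≤ ((n : ℝ≥0) + 1) * h := fun n => by
    gcongr; exact le_self_add
  have hΔmeas : ∀ n < N, Measurable[𝓕 ((n + 1) * h)] fun ω => W ((n + 1) * h) ω - W (n * h) ω :=
    fun n hn => (hW.adapted _ (htime' n hn)).sub
      ((hW.adapted _ (htime n hn.le)).mono (𝓕.mono (hle n)) le_rfl)
  have hSmeas : ∀ n ≤ N, Measurable[ℱ n] (energyMajorant g W h Y b C n) := by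
    intro n hn
    refine Measurable.add measurable_const (Finset.measurable_fun_sum _ fun k hk => ?_)
    have hk : k < n := Finset.mem_range.1 hk
    have hk1 : 𝓕 ((k + 1) * h) ≤ ℱ n := 𝓕.mono (by
      have : ((k + 1 : ℕ) : ℝ≥0) ≤ n := by exact_mod_cast hk
      push_cast at this
      gcongr)
    exact (Measurable.energyIncrement hg h
      ((hY.adapted k (by omega)).mono (ℱ.mono hk.le) le_rfl)
      ((hΔmeas k (by omega)).mono hk1 le_rfl)).const_mul _
  have hS0 : ∀ᵐ ω ∂P, ∀ n ≤ N, 0 ≤ energyMajorant g W h Y b C n ω := by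
    filter_upwards [hae] with ω hω n hn
    exact le_trans (by positivity) (hω n hn)
  have hmax := mul_measure_exists_le_le_lintegral (μ := P) ℱ
    (fun n ω => ENNReal.ofReal (energyMajorant g W h Y b C n ω)) N
    (fun n hn => (hSmeas n hn).ennreal_ofReal)
    (fun n hn A hA => by
      have hvar : ((n : ℝ≥0) + 1) * h - n * h = h := by
        rw [add_mul, one_mul, add_tsub_cancel_left]
      have hgauss := hW.gaussian_components _ _ (hle n) (htime' n hn)
      rw [hvar] at hgauss
      have hrec : ∀ ω, energyMajorant g W h Y b C (n + 1) ω = energyMajorant g W h Y b C n ω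
          + b ^ (n + 1) * energyIncrement g h (Y n ω) (W ((n + 1) * h) ω - W (n * h) ω) := fun ω => by
        simp only [energyMajorant, Finset.sum_range_succ]; ring
      simp_rw [hrec]
      have hΔ := (hΔmeas n hn).mono (𝓕.le _) le_rfl
      refine (setLIntegral_ofReal_add_energyIncrement (m' := ℱ n) (mΩ := mΩ) hg (ℱ.le n) hΔ
        (hW.indep_past _ _ (hle n) (htime' n hn))
        (hW.indep_components _ _ (hle n) (htime' n hn)) hgauss (hSmeas n hn.le)
        (hY.adapted n hn.le) _ ?_ hA).le
      filter_upwards [hS0] with ω hω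
      rw [← hrec]
      exact hω _ hn)
    -- As `b ≤ 1`, this level lies below `b ^ (j + 1) * t` for every `j ≤ N`, whichever index
    -- attains the maximum.
    (ENNReal.ofReal (b ^ (N + 1) * t))
  have hint : ∫⁻ ω, ENNReal.ofReal (energyMajorant g W h Y b C 0 ω) ∂P = ENNReal.ofReal C := by
    simp [energyMajorant]
  rw [hint] at hmax
  have hbt : 0 < b ^ (N + 1) * t := by positivity
  have hsub : P {ω | t ≤ (⨆ j : Fin (N + 1), ‖Y j ω‖) ^ 2} ≤
      P {ω | ∃ n ≤ N, ENNReal.ofReal (b ^ (N + 1) * t) ≤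
        ENNReal.ofReal (energyMajorant g W h Y b C n ω)} := by
    refine measure_mono_ae ?_
    filter_upwards [hae] with ω hω hωt
    obtain ⟨j, hj⟩ := exists_eq_ciSup_of_finite (f := fun j : Fin (N + 1) => ‖Y j ω‖)
    have hjN : (j : ℕ) ≤ N := by omega
    have hωt : t ≤ (⨆ j : Fin (N + 1), ‖Y j ω‖) ^ 2 := hωt
    rw [← hj] at hωt
    refine ⟨j, hjN, ENNReal.ofReal_le_ofReal ?_⟩
    calc b ^ (N + 1) * t ≤ b ^ ((j : ℕ) + 1) * ‖Y j ω‖ ^ 2 :=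
          mul_le_mul (pow_le_pow_of_le_one hb.le hb1 (by omega)) hωt ht.le (by positivity)
      _ = b ^ (j : ℕ) * (b * ‖Y j ω‖ ^ 2 + 0) := by ring
      _ ≤ b ^ (j : ℕ) * (b * ‖Y j ω‖ ^ 2 + h * ‖g (Y j ω)‖ ^ 2) := by gcongr; positivity
      _ ≤ _ := hω j hjN
  refine hsub.trans ?_
  rw [div_div, ENNReal.ofReal_div_of_pos hbt, ENNReal.le_div_iff_mul_le (by simp [hbt])
    (by simp), mul_comm]
  exact hmax

end Scheme

/-! ### Moment bound and uniformity in the step size. -/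

/-- `L^{2p}` bound for the running maximum of the scheme, in terms of its actual step size. -/
theorem IsBackwardEulerMaruyama.eLpNorm_iSup_le {Ω : Type*} {mΩ : MeasurableSpace Ω}
    {P : Measure Ω} [IsProbabilityMeasure P] {d m : ℕ} {T : ℝ≥0}
    {𝓕 : Filtration ℝ≥0 mΩ} {W : ℝ≥0 → Ω → EuclideanSpace ℝ (Fin m)}
    {f : EuclideanSpace ℝ (Fin d) → EuclideanSpace ℝ (Fin d)}
    {g : EuclideanSpace ℝ (Fin d) → Matrix (Fin d) (Fin m) ℝ}
    {X₀ : EuclideanSpace ℝ (Fin d)} {L : ℝ} {h : ℝ≥0} {N : ℕ}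
    {Y : ℕ → Ω → EuclideanSpace ℝ (Fin d)}
    (hW : IsWienerProcessUpTo T 𝓕 W P) (hg : ∀ i k, Measurable (fun x => g x i k))
    (hY : IsBackwardEulerMaruyama f g X₀ 𝓕 W P h N Y) (hfg : CoercivityCondition f g L)
    (hL : 0 ≤ L) (hb : 0 < 1 - 2 * h * L) (hN : N * h ≤ T) {p : ℝ} (hp0 : 0 < p) (hp1 : p < 1) :
    eLpNorm (fun ω => ⨆ j : Fin (N + 1), ‖Y j ω‖) (ENNReal.ofReal (2 * p)) P ≤
      ENNReal.ofReal ((1 / (1 - p)) ^ (1 / (2 * p)) *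
        (((1 - 2 * h * L) * ‖X₀‖ ^ 2 + h * ‖g X₀‖ ^ 2 + 2 * N * h * L)
          / (1 - 2 * h * L) ^ (N + 1)) ^ (1 / 2 : ℝ)) := by
  set D : ℝ := ((1 - 2 * h * L) * ‖X₀‖ ^ 2 + h * ‖g X₀‖ ^ 2 + 2 * N * h * L)
    / (1 - 2 * h * L) ^ (N + 1) with hD
  have hD0 : 0 ≤ D := by positivity
  have hYm : ∀ j : Fin (N + 1), Measurable (Y j) := fun j =>
    (hY.adapted j (by omega)).mono (𝓕.le _) le_rfl
  have hQm : Measurable fun ω => ⨆ j : Fin (N + 1), ‖Y j ω‖ :=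
    Measurable.iSup fun j => (hYm j).norm
  have hQ0 : ∀ ω, 0 ≤ ⨆ j : Fin (N + 1), ‖Y j ω‖ := fun ω =>
    Real.iSup_nonneg fun j => norm_nonneg _
  have hmom := lintegral_rpow_le_of_measure_le_div (μ := P)
    (f := fun ω => (⨆ j : Fin (N + 1), ‖Y j ω‖) ^ 2) (fun ω => sq_nonneg _)
    (hQm.pow_const 2).aemeasurable hD0
    (fun t ht => hY.measure_le_iSup_sq_le hW hg hfg hL hb hN ht) hp0 hp1
  have hp2 : 0 < 2 * p := by positivity
  have hp1' : 0 < 1 - p := by linarith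
  rw [eLpNorm_eq_lintegral_rpow_enorm_toReal (by simpa using hp0) ENNReal.ofReal_ne_top,
    ENNReal.toReal_ofReal hp2.le]
  have hcongr : ∫⁻ ω, ‖⨆ j : Fin (N + 1), ‖Y j ω‖‖ₑ ^ (2 * p) ∂P
      = ∫⁻ ω, ENNReal.ofReal (((⨆ j : Fin (N + 1), ‖Y j ω‖) ^ 2) ^ p) ∂P := by
    refine lintegral_congr fun ω => ?_
    rw [Real.enorm_of_nonneg (hQ0 ω), ENNReal.ofReal_rpow_of_nonneg (hQ0 ω) hp2.le,
      Real.rpow_mul (hQ0 ω), Real.rpow_two]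
  rw [hcongr]
  refine (ENNReal.rpow_le_rpow hmom (by positivity)).trans (le_of_eq ?_)
  rw [ENNReal.ofReal_rpow_of_nonneg (by positivity) (by positivity)]
  congr 1
  rw [div_eq_mul_one_div, mul_comm, Real.mul_rpow (by positivity) (by positivity),
    ← Real.rpow_mul hD0]
  congr 2
  field_simp

/-- Write `1/(1-x) = 1 + x/(1-x)` and use `1 + u ≤ exp u`. -/
theorem one_div_one_sub_pow_le_exp {x : ℝ} (hx : x < 1) (n : ℕ) :
    1 / (1 - x) ^ n ≤ Real.exp (n * (x / (1 - x))) := by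
  have h1 : 0 < 1 - x := by linarith
  have h2 : 1 / (1 - x) ≤ Real.exp (x / (1 - x)) := by
    refine le_trans (le_of_eq ?_) (Real.add_one_le_exp _)
    field_simp
    ring
  rw [Real.exp_nat_mul, ← one_div_pow]
  gcongr

theorem mainTheorem4 {Ω : Type*} {mΩ : MeasurableSpace Ω} (P : Measure Ω) [IsProbabilityMeasure P]
    {d m : ℕ} (T : ℝ≥0) (𝓕 : Filtration ℝ≥0 mΩ)
    (W : ℝ≥0 → Ω → EuclideanSpace ℝ (Fin m)) (hW : IsWienerProcessUpTo T 𝓕 W P)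
    (f : EuclideanSpace ℝ (Fin d) → EuclideanSpace ℝ (Fin d))
    (g : EuclideanSpace ℝ (Fin d) → Matrix (Fin d) (Fin m) ℝ)
    (hg : ∀ i k, Measurable (fun x => g x i k))
    (X₀ : EuclideanSpace ℝ (Fin d))
    (L : ℝ) (hL : 0 ≤ L) (hfg : CoercivityCondition f g L)
    -- For `L > 0` the second condition says `h₀ < (2L)⁻¹`; for `L = 0` it is no restriction.
    (h₀ : ℝ) (hh₀ : 0 < h₀) (hh₀L : 2 * L * h₀ < 1)
    (p : ℝ) (hp0 : 0 < p) (hp1 : p < 1) :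
    ∀ (h : ℝ≥0), 0 < h → (h : ℝ) < h₀ →
    ∀ (N : ℕ), N * h ≤ T → T < (N + 1) * h →
    ∀ (Y : ℕ → Ω → EuclideanSpace ℝ (Fin d)), IsBackwardEulerMaruyama f g X₀ 𝓕 W P h N Y →
      eLpNorm (fun ω => ⨆ j : Fin (N + 1), ‖Y j ω‖) (ENNReal.ofReal (2 * p)) P ≤
        ENNReal.ofReal
          (((2 - p) / (1 - p)) ^ (1 / (2 * p)) * Real.exp (L * T / (1 - 2 * h₀ * L)) *
            (‖X₀‖ ^ 2 + (1 - 2 * h₀ * L)⁻¹ * (h₀ * ‖g X₀‖ ^ 2 + 2 * L * T)) ^ (1 / 2 : ℝ)) := by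
  intro h hh hhh₀ N hNT _ Y hY
  have hNT' : (N : ℝ) * h ≤ T := by exact_mod_cast hNT
  have hhL : 2 * h * L ≤ 2 * h₀ * L := by gcongr
  have hb₀ : 0 < 1 - 2 * h₀ * L := by linarith
  have hb : 0 < 1 - 2 * h * L := by linarith
  have hp1' : 0 < 1 - p := by linarith
  have hh' : (0 : ℝ) ≤ h := h.2
  have hT : (0 : ℝ) ≤ T := T.2
  refine (hY.eLpNorm_iSup_le hW hg hfg hL hb hNT hp0 hp1).trans (ENNReal.ofReal_le_ofReal ?_)
  set K : ℝ := ‖X₀‖ ^ 2 + (1 - 2 * h₀ * L)⁻¹ * (h₀ * ‖g X₀‖ ^ 2 + 2 * L * T) with hK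
  have hK0 : 0 ≤ K := by positivity
  have hD : ((1 - 2 * h * L) * ‖X₀‖ ^ 2 + h * ‖g X₀‖ ^ 2 + 2 * N * h * L)
      / (1 - 2 * h * L) ^ (N + 1) ≤ Real.exp (2 * (L * T / (1 - 2 * h₀ * L))) * K := by
    -- One of the `N + 1` factors of the denominator goes into the bracket, so the exponential only
    -- sees `N h ≤ T`.
    have e : ((1 - 2 * h * L) * ‖X₀‖ ^ 2 + h * ‖g X₀‖ ^ 2 + 2 * N * h * L)
        / (1 - 2 * h * L) ^ (N + 1) = 1 / (1 - 2 * h * L) ^ N *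
          (‖X₀‖ ^ 2 + (1 - 2 * h * L)⁻¹ * (h * ‖g X₀‖ ^ 2 + 2 * L * (N * h))) := by
      rw [pow_succ]
      field_simp
      ring
    rw [e]
    refine mul_le_mul ?_ ?_ (by positivity) (by positivity)
    · refine (one_div_one_sub_pow_le_exp (by linarith) N).trans (Real.exp_le_exp.2 ?_)
      calc N * (2 * h * L / (1 - 2 * h * L)) = 2 * (L * (N * h) / (1 - 2 * h * L)) := by ring
        _ ≤ 2 * (L * T / (1 - 2 * h₀ * L)) := by gcongr
    · rw [hK]
      gcongr
  have hsqrt : (Real.exp (2 * (L * T / (1 - 2 * h₀ * L))) * K) ^ (1 / 2 : ℝ)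
      = Real.exp (L * T / (1 - 2 * h₀ * L)) * K ^ (1 / 2 : ℝ) := by
    rw [Real.mul_rpow (Real.exp_pos _).le hK0, ← Real.exp_mul]
    congr 2
    ring
  rw [mul_assoc _ (Real.exp _), ← hsqrt]
  have h2p : 0 ≤ (2 - p) / (1 - p) := div_nonneg (by linarith) hp1'.le
  gcongr
  -- The argument gives the constant `1/(1-p)`; the stated one is larger because `1 ≤ 2 - p`.
  linarith
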